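/- All graphs are finite, undirected and simple. A set $S\subseteq V(G)$ is a total dominating set of $G$ if every vertex of $G$ is adjacent to a vertex of $S$; $\gamma_t(G)$ is the minimum cardinality of such a set. A graph $G$ is $k$-$\gamma_t$-vertex-critical if $\gamma_t(G)=k$ and $\gamma_t(G-v)<\gamma_t(G)$ for every vertex $v$ that is not adjacent to a vertex of degree one (in particular, $G-v$ then has a total dominating set). A pointed graph is a graph with two marked vertices, Left and Right; for pointed graphs $G_1,G_2$, the pointed graph $G_1\bullet G_2$ is obtained by identifying the Right vertex of $G_1$ with the Left vertex of $G_2$, its marked vertices being the Left vertex of $G_1$ and the Right vertex of $G_2$. Let $m\ge 2$. Let $K_{m,m}$ be the complete bipartite graph with parts $\{y_1,y_3,\dots,y_{2m-1}\}$ and $\{y_2,y_4,\dots,y_{2m}\}$, let $F=K_{m,m}-y_1y_{2m}$, and let $\overline F$ be the complement of $F$, taken on the vertices $x_1,\dots,x_{2m}$ with $x_i$ corresponding to $y_i$. The pointed graph $R$ is obtained from the disjoint union of $\overline F$ and $K_{m,m}$ by joining $x_i$ to $y_j$ for all $i\ne j$ and adding five new vertices $z_1,z_2,z_3$, Left, Right,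 where Left is adjacent to all $x_i$; $z_1$ is adjacent to $x_1,\dots,x_{2m-1},y_2,\dots,y_{2m-1}$; $z_2$ is adjacent to $x_2,\dots,x_{2m},y_2,\dots,y_{2m-1}$; $z_3$ is adjacent to all $y_i$ and to $z_1$; and Right is adjacent to all $y_i$ and to $z_2$. Let $H$ be a graph on $t\ge 4$ vertices with $\gamma_t(H)=\gamma_t(\overline H)=2$. The pointed graph $A$ is obtained from the disjoint union of $H$ (on $x_1,\dots,x_t$) and $\overline H$ (on $y_1,\dots,y_t$, with $x_i$ corresponding to $y_i$) by joining $x_i$ to $y_j$ for all $i\neq j$ and adding a vertex Left adjacent to all $x_i$ and a vertex Right adjacent to all $y_i$. The pointed graph $Q$ is obtained from two disjoint copies $A_1,A_2$ of $A$ by deleting the Right vertex of $A_1$ and the Left vertex of $A_2$ and joining every neighbour of the former (in $A_1$) to every neighbour of the latter (in $A_2$); its marked vertices are the Left vertex of $A_1$ and the Right vertex of $A_2$. Let $Q^{(0)}$ be a single vertex (both Left and Right), $Q^{(1)}=Q$, and $Q^{(n)}=Q^{(n-1)}\bullet Q$ for $n\ge 2$. Theorem. For all such $m$ and $H$ and every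 integer $n\ge 0$, the graph $R\bullet Q^{(n)}\bullet R\bullet R$ is $(3n+7)$-$\gamma_t$-vertex-critical and has diameter $5n+9$. -/

import Mathlib

universe u

namespace TotalDomination

/-- `S` is a total dominating set of `G`: every vertex has a neighbour in `S`. -/
def IsTotalDominating {V : Type u} (G : SimpleGraph V) (S : Set V) : Prop :=
  ∀ v, ∃ w ∈ S, G.Adj v w

/-- The total domination number: the minimum cardinality of a total dominating set.
It is `⊤` when there is no total dominating set (that is, if some vertex is isolated). -/
noncomputable def totalDominationNumber {V : Type u} (G : SimpleGraph V) : ℕ∞ :=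
  ⨅ S : {S : Set V // IsTotalDominating G S}, S.1.encard

/-- The graph `G - v`. -/
abbrev removeVertex {V : Type u} (G : SimpleGraph V) (v : V) :
    SimpleGraph ({v}ᶜ : Set V) :=
  G.induce {v}ᶜ

/-- `G` is total domination vertex critical: removing any vertex that is not adjacent to a
vertex of degree one decreases the total domination number. -/
def IsVertexCritical {V : Type u} (G : SimpleGraph V) : Prop :=
  ∀ v, (¬ ∃ w, G.Adj v w ∧ (G.neighborSet w).encard = 1) →
    totalDominationNumber (removeVertex G v) < totalDominationNumber G

/-- `G` is `k`-`γ_t`-vertex-critical. -/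
def IsKVertexCritical {V : Type u} (G : SimpleGraph V) (k : ℕ) : Prop :=
  IsVertexCritical G ∧ totalDominationNumber G = k

/-- A graph with two marked vertices `left` and `right`. (In all graphs built below these two
vertices are at distance equal to the diameter; the constructions do not use this.) -/
structure PointedGraph where
  V : Type u
  graph : SimpleGraph V
  left : V
  right : V

namespace PointedGraph

/-- Adjacency of `G₁ • G₂`. The identified vertex is represented by `inl G₁.right`. -/
def dotAdj (G₁ G₂ : PointedGraph.{u}) :
    G₁.V ⊕ {v : G₂.V // v ≠ G₂.left} → G₁.V ⊕ {v : G₂.V // v ≠ G₂.left} → Prop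
  | .inl a, .inl b => G₁.graph.Adj a b
  | .inr a, .inr b => G₂.graph.Adj a.1 b.1
  | .inl a, .inr b => a = G₁.right ∧ G₂.graph.Adj G₂.left b.1
  | .inr a, .inl b => b = G₁.right ∧ G₂.graph.Adj G₂.left a.1

open Classical in
/-- `G₁ • G₂`: identify the `right` vertex of `G₁` with the `left` vertex of `G₂`; the marked
vertices are then the `left` vertex of `G₁` and the `right` vertex of `G₂`. -/
noncomputable def dot (G₁ G₂ : PointedGraph.{u}) : PointedGraph.{u} where
  V := G₁.V ⊕ {v : G₂.V // v ≠ G₂.left}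
  graph :=
    { Adj := dotAdj G₁ G₂
      symm := ⟨by
        rintro (a | a) (b | b) h
        · exact G₁.graph.adj_symm h
        · exact h
        · exact h
        · exact G₂.graph.adj_symm h⟩
      loopless := ⟨by
        rintro (a | a) h
        · exact G₁.graph.irrefl h
        · exact G₂.graph.irrefl h⟩ }
  left := .inl G₁.left
  right := if h : G₂.right = G₂.left then .inl G₁.right else .inr ⟨G₂.right, h⟩

/-- The one-vertex graph, a neutral element for `•` up to isomorphism. -/
def point : PointedGraph.{u} where
  V := PUnit
  graph := ⊥
  left := PUnit.unit
  right := PUnit.unit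

/-- `G^(0)` is a single vertex, `G^(1) = G`, and `G^(n) = G^(n-1) • G` for `n ≥ 2`. -/
noncomputable def dotPow (G : PointedGraph.{u}) : ℕ → PointedGraph.{u}
  | 0 => point
  | 1 => G
  | n + 2 => (dotPow G (n + 1)).dot G

end PointedGraph

/-! ### The graph `R`, with parameter `m`

The index `i : Fin (2 * m)` stands for the subscript `i + 1`, which runs from `1` to `2m`. -/

/-- `K_{m,m}` on `y_1, …, y_{2m}`, with parts the odd and the even subscripts. -/
def graphK (m : ℕ) : SimpleGraph (Fin (2 * m)) where
  Adj i j := i.val % 2 ≠ j.val % 2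
  symm := ⟨fun _ _ h => h.symm⟩
  loopless := ⟨fun _ h => h rfl⟩

/-- The subscript `1`. -/
def IsFirst {m : ℕ} (i : Fin (2 * m)) : Prop := i.val = 0

/-- The subscript `2m`. -/
def IsLast {m : ℕ} (i : Fin (2 * m)) : Prop := i.val + 1 = 2 * m

/-- `F`: the graph `K_{m,m}` without the edge `y_1 y_{2m}`. -/
def graphF (m : ℕ) : SimpleGraph (Fin (2 * m)) where
  Adj i j := (graphK m).Adj i j ∧ ¬ (IsFirst i ∧ IsLast j) ∧ ¬ (IsLast i ∧ IsFirst j)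
  symm := ⟨fun _ _ h => ⟨h.1.symm, fun k => h.2.2 ⟨k.2, k.1⟩, fun k => h.2.1 ⟨k.2, k.1⟩⟩⟩
  loopless := ⟨fun _ h => (graphK m).irrefl h.1⟩

inductive RVertex (m : ℕ) : Type u
  | left
  | right
  | z₁
  | z₂
  | z₃
  | x (i : Fin (2 * m))
  | y (i : Fin (2 * m))

/-- The edges of `R`, each listed in one direction. -/
def RRel (m : ℕ) : RVertex.{u} m → RVertex.{u} m → Prop
  | .x i, .x j => (graphF m)ᶜ.Adj i j
  | .y i, .y j => (graphK m).Adj i j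
  | .x i, .y j => i ≠ j
  | .left, .x _ => True
  | .z₁, .x i => ¬ IsLast i
  | .z₁, .y i => ¬ IsFirst i ∧ ¬ IsLast i
  | .z₂, .x i => ¬ IsFirst i
  | .z₂, .y i => ¬ IsFirst i ∧ ¬ IsLast i
  | .z₃, .y _ => True
  | .z₃, .z₁ => True
  | .right, .y _ => True
  | .right, .z₂ => True
  | _, _ => False

/-- The pointed graph `R`. -/
def graphR (m : ℕ) : PointedGraph.{u} where
  V := RVertex.{u} m
  graph := SimpleGraph.fromRel (RRel m)
  left := .left
  right := .right

/-! ### The graphs `A` and `Q` built from a graph `H` -/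

inductive AVertex (W : Type u) : Type u
  | left
  | right
  | x (w : W)
  | y (w : W)

/-- The edges of `A`, each listed in one direction: the `x`-vertices carry `H`, the `y`-vertices
carry the complement of `H`. -/
def ARel {W : Type u} (H : SimpleGraph W) : AVertex W → AVertex W → Prop
  | .x i, .x j => H.Adj i j
  | .y i, .y j => Hᶜ.Adj i j
  | .x i, .y j => i ≠ j
  | .left, .x _ => True
  | .right, .y _ => True
  | _, _ => False

/-- The pointed graph `A`. -/
def graphA {W : Type u} (H : SimpleGraph W) : PointedGraph.{u} where
  V := AVertex W
  graph := SimpleGraph.fromRel (ARel H)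
  left := .left
  right := .right

/-- Adjacency of `Q`: two copies of `A`, the first without its `right` vertex and the second
without its `left` vertex, where every neighbour of the deleted `right` vertex is joined to
every neighbour of the deleted `left` vertex. -/
def QAdj {W : Type u} (H : SimpleGraph W) :
    {v : AVertex W // v ≠ .right} ⊕ {v : AVertex W // v ≠ .left} →
    {v : AVertex W // v ≠ .right} ⊕ {v : AVertex W // v ≠ .left} → Prop
  | .inl a, .inl b => (graphA H).graph.Adj a.1 b.1
  | .inr a, .inr b => (graphA H).graph.Adj a.1 b.1
  | .inl a, .inr b => (graphA H).graph.Adj .right a.1 ∧ (graphA H).graph.Adj .left b.1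
  | .inr a, .inl b => (graphA H).graph.Adj .right b.1 ∧ (graphA H).graph.Adj .left a.1

/-- The pointed graph `Q`. -/
def graphQ {W : Type u} (H : SimpleGraph W) : PointedGraph.{u} where
  V := {v : AVertex W // v ≠ .right} ⊕ {v : AVertex W // v ≠ .left}
  graph :=
    { Adj := QAdj H
      symm := ⟨by
        rintro (a | a) (b | b) h
        · exact (graphA H).graph.adj_symm h
        · exact h
        · exact h
        · exact (graphA H).graph.adj_symm h⟩
      loopless := ⟨by
        rintro (a | a) h
        · exact (graphA H).graph.irrefl h
        · exact (graphA H).graph.irrefl h⟩ }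
  left := .inl ⟨.left, nofun⟩
  right := .inr ⟨.right, nofun⟩

/-- The pointed graph `R • Q^(n) • R • R`. -/
noncomputable def graphRQRR {W : Type u} (H : SimpleGraph W) (m n : ℕ) : PointedGraph.{u} :=
  (((graphR m).dot ((graphQ H).dotPow n)).dot (graphR m)).dot (graphR m)

end TotalDomination

/-!
In `X • Y` a set `S` of vertices splits into the parts `S ∩ X` and `S ∩ Y`, which share at most the
cut vertex. The cut vertex has to be dominated from only one side, but if it lies in `S` then it is
counted on both. A lower bound for `|S ∩ X|` that is weakened by one for each marked vertex that is
dominated from outside `X` without lying in `S` is therefore additive: what one factor gains at the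
cut vertex the other one loses. For the upper bounds, sets for the two factors that agree at the cut
vertex are glued together; the factor that does not have to dominate it saves one vertex.

For `R`, the lower bound rests on the fact that no pair `x_i, y_j` dominates all of `y_i`, `x_j`,
`z₁` and `z₂`. For `Q`, it rests on the fact that one vertex among Left and the `x_i` of the first
copy of `A`, one among Right and the `y_i` of the second copy, and any third vertex do not dominate
all other vertices.

The diameter is additive as well, because in each factor the distance between the two marked
vertices equals the diameter.
-/

namespace TotalDomination

section Domination

variable {V : Type*} {G : SimpleGraph V} {S : Set V} {v : V} {l : List V}

/-- `S` dominates `v` if `v` has a neighbour in `S`, so that `S` is a total dominating set of `G`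
exactly if it dominates every vertex. -/
def Dominates (G : SimpleGraph V) (S : Set V) (v : V) : Prop :=
  ∃ w ∈ S, G.Adj v w

lemma mem_or_dominates_iff : v ∈ S ∨ Dominates G S v ↔ ∃ w ∈ S, w = v ∨ G.Adj v w := by
  simp [Dominates, and_or_left, exists_or]

lemma length_le_encard (hl : l.Nodup) (hlS : ∀ w ∈ l, w ∈ S) : l.length ≤ S.encard := by
  classical
  rw [← List.toFinset_card_of_nodup hl, ← Set.encard_coe_eq_coe_finsetCard]
  exact Set.encard_le_encard fun w hw => hlS w (by simpa using hw)

lemma length_add_one_le_encard (hl : l.Nodup) (hlS : ∀ w ∈ l, w ∈ S) (hv : Dominates G S v)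
    (hlv : ∀ w ∈ l, ¬ G.Adj v w) : (l.length + 1 : ℕ) ≤ S.encard := by
  obtain ⟨s, hs, hvs⟩ := hv
  exact length_le_encard (l := s :: l) (List.nodup_cons.2 ⟨fun h => hlv s h hvs, hl⟩)
    (List.forall_mem_cons.2 ⟨hs, hlS⟩)

lemma encard_setOf_mem_list_le (l : List V) : {v | v ∈ l}.encard ≤ l.length := by
  classical
  rw [← List.coe_toFinset, Set.encard_coe_eq_coe_finsetCard]
  exact_mod_cast l.toFinset_card_le

end Domination

lemma exists_isTotalDominating_pair {V : Type u} {G : SimpleGraph V}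
    (h : totalDominationNumber G = 2) : ∃ p q, IsTotalDominating G {p, q} := by
  rcases isEmpty_or_nonempty {S : Set V // IsTotalDominating G S} with hE | hE
  · simp [totalDominationNumber, iInf_of_empty] at h
  obtain ⟨⟨S, hS⟩, hmin⟩ :=
    ENat.exists_eq_iInf fun S : {S : Set V // IsTotalDominating G S} => S.1.encard
  obtain ⟨p, q, -, rfl⟩ := Set.encard_eq_two.1 (hmin.trans h)
  exact ⟨p, q, hS⟩

section Distance

variable {V W : Type*} {G : SimpleGraph V} {G' : SimpleGraph W} {v w : V}

lemma edist_map_le (f : G →g G') (v w : V) :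
    G'.edist (f v) (f w) ≤ G.edist v w := by
  by_cases h : G.edist v w = ⊤
  · exact h ▸ le_top
  · obtain ⟨p, hp⟩ := SimpleGraph.exists_walk_of_edist_ne_top h
    rw [← hp, ← p.length_map f]
    exact SimpleGraph.edist_le _

lemma edist_le_add_one_of_adj {u : V} {k : ℕ} (h : G.Adj u v) (hvw : G.edist v w ≤ k) :
    G.edist u w ≤ (k + 1 : ℕ) :=
  calc G.edist u w ≤ G.edist u v + G.edist v w := G.edist_triangle
    _ = 1 + G.edist v w := by rw [SimpleGraph.edist_eq_one_iff_adj.2 h]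
    _ ≤ (k + 1 : ℕ) := by rw [add_comm]; push_cast; gcongr

lemma edist_le_add {u : V} {k ℓ : ℕ} (hv : G.edist v u ≤ k) (hw : G.edist w u ≤ ℓ) :
    G.edist v w ≤ (k + ℓ : ℕ) := by
  push_cast
  exact G.edist_triangle.trans (add_le_add hv (SimpleGraph.edist_comm.trans_le hw))

lemma edist_le_three_of_adj {a b : V} (hab : G.Adj a b) (hv : G.Adj v a ∨ G.Adj v b)
    (hw : G.Adj w a ∨ G.Adj w b) : G.edist v w ≤ (3 : ℕ) := by
  have hone {c : V} (h : G.Adj w c) : G.edist c w ≤ (1 : ℕ) :=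
    (SimpleGraph.edist_eq_one_iff_adj.2 h.symm).le
  have hnear : G.edist a w ≤ (2 : ℕ) ∧ G.edist b w ≤ (2 : ℕ) := by
    rcases hw with hw | hw
    · exact ⟨(hone hw).trans (by norm_num), edist_le_add_one_of_adj hab.symm (hone hw)⟩
    · exact ⟨edist_le_add_one_of_adj hab (hone hw), (hone hw).trans (by norm_num)⟩
  rcases hv with hv | hv
  · exact edist_le_add_one_of_adj hv hnear.1
  · exact edist_le_add_one_of_adj hv hnear.2

lemma le_add_length_of_adj {f : V → ℕ} (hf : ∀ v w, G.Adj v w → f w ≤ f v + 1) (p : G.Walk v w) :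
    f w ≤ f v + p.length := by
  induction p with
  | nil => simp
  | cons h p ih =>
    have := hf _ _ h
    rw [SimpleGraph.Walk.length_cons]
    omega

end Distance

open Classical in
/-- The Iverson bracket `[p]`: the number `1` if `p` holds and `0` otherwise. -/
noncomputable def iverson (p : Prop) : ℕ := if p then 1 else 0

namespace PointedGraph

section Product

variable {X Y : PointedGraph.{u}} {a b c : Prop}

/-- The vertex of `X • Y` given by a vertex of `X`. -/
def ofLeft (X Y : PointedGraph.{u}) (v : X.V) : (X.dot Y).V := .inl v

open Classical in
/-- The vertex of `X • Y` given by a vertex of `Y`; the left vertex of `Y` becomes the right vertex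
of `X`. -/
noncomputable def ofRight (X Y : PointedGraph.{u}) (w : Y.V) : (X.dot Y).V :=
  if h : w = Y.left then .inl X.right else .inr ⟨w, h⟩

lemma ofRight_left : ofRight X Y Y.left = ofLeft X Y X.right := dif_pos rfl

lemma ofRight_of_ne {w : Y.V} (h : w ≠ Y.left) : ofRight X Y w = .inr ⟨w, h⟩ := dif_neg h

lemma dot_right : (X.dot Y).right = ofRight X Y Y.right := rfl

lemma ofLeft_injective : Function.Injective (ofLeft X Y) := Sum.inl_injective

lemma ofLeft_eq_ofRight_iff {v : X.V} {w : Y.V} :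
    ofLeft X Y v = ofRight X Y w ↔ v = X.right ∧ w = Y.left := by
  by_cases h : w = Y.left
  · simp [h, ofRight_left, ofLeft_injective.eq_iff]
  · simp [ofRight_of_ne h, h, ofLeft]

lemma ofRight_injective : Function.Injective (ofRight X Y) := by
  intro v w h
  by_cases hv : v = Y.left <;> by_cases hw : w = Y.left
  · rw [hv, hw]
  · rw [hv, ofRight_left, ofLeft_eq_ofRight_iff] at h
    exact absurd h.2 hw
  · rw [hw, ofRight_left, eq_comm, ofLeft_eq_ofRight_iff] at h
    exact absurd h.2 hv
  · rw [ofRight_of_ne hv, ofRight_of_ne hw] at h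
    exact congrArg Subtype.val (Sum.inr_injective h)

lemma dot_cases {P : (X.dot Y).V → Prop} (ofLeft : ∀ v, P (ofLeft X Y v))
    (ofRight : ∀ w, w ≠ Y.left → P (ofRight X Y w)) (u : (X.dot Y).V) : P u := by
  rcases u with v | ⟨w, hw⟩
  · exact ofLeft v
  · exact ofRight_of_ne hw ▸ ofRight w hw

lemma dot_adj_ofLeft_ofRight {v : X.V} {w : Y.V} (hw : w ≠ Y.left) :
    (X.dot Y).graph.Adj (ofLeft X Y v) (ofRight X Y w) ↔ v = X.right ∧ Y.graph.Adj Y.left w := by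
  rw [ofRight_of_ne hw]
  exact Iff.rfl

lemma dot_adj_ofRight_ofRight {v w : Y.V} :
    (X.dot Y).graph.Adj (ofRight X Y v) (ofRight X Y w) ↔ Y.graph.Adj v w := by
  by_cases hv : v = Y.left <;> by_cases hw : w = Y.left
  · simp [hv, hw]
  · simp [hv, ofRight_left, dot_adj_ofLeft_ofRight hw]
  · rw [SimpleGraph.adj_comm, SimpleGraph.adj_comm Y.graph, hw, ofRight_left,
      dot_adj_ofLeft_ofRight hv]
    simp
  · rw [ofRight_of_ne hv, ofRight_of_ne hw]
    exact Iff.rfl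

lemma encard_preimage_add_encard_preimage (S : Set (X.dot Y).V) :
    (ofLeft X Y ⁻¹' S).encard + (ofRight X Y ⁻¹' S).encard =
      S.encard + iverson (ofLeft X Y X.right ∈ S) := by
  have hunion : ofLeft X Y '' (ofLeft X Y ⁻¹' S) ∪ ofRight X Y '' (ofRight X Y ⁻¹' S) = S := by
    rw [Set.image_preimage_eq_inter_range, Set.image_preimage_eq_inter_range,
      ← Set.inter_union_distrib_left, Set.inter_eq_left]
    intro u _
    induction u using dot_cases with
    | ofLeft v => exact .inl ⟨v, rfl⟩
    | ofRight w _ => exact .inr ⟨w, rfl⟩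
  have hinter : ofLeft X Y '' (ofLeft X Y ⁻¹' S) ∩ ofRight X Y '' (ofRight X Y ⁻¹' S) =
      {u | u = ofLeft X Y X.right ∧ ofLeft X Y X.right ∈ S} := by
    ext u
    constructor
    · rintro ⟨⟨v, hv, rfl⟩, w, -, hvw⟩
      obtain ⟨rfl, -⟩ := ofLeft_eq_ofRight_iff.1 hvw.symm
      exact ⟨rfl, hv⟩
    · rintro ⟨rfl, hS⟩
      exact ⟨⟨_, hS, rfl⟩, Y.left, by rwa [Set.mem_preimage, ofRight_left], ofRight_left⟩
  rw [← ofLeft_injective.encard_image (ofLeft X Y ⁻¹' S),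
    ← ofRight_injective.encard_image (ofRight X Y ⁻¹' S), ← Set.encard_union_add_encard_inter,
    hunion, hinter]
  congr 1
  by_cases hS : ofLeft X Y X.right ∈ S <;> simp [hS, iverson]

lemma dominates_ofLeft_iff {S : Set (X.dot Y).V} {v : X.V} :
    Dominates (X.dot Y).graph S (ofLeft X Y v) ↔ Dominates X.graph (ofLeft X Y ⁻¹' S) v ∨
      v = X.right ∧ Dominates Y.graph (ofRight X Y ⁻¹' S) Y.left := by
  constructor
  · rintro ⟨u, hu, hvu⟩
    induction u using dot_cases with
    | ofLeft w => exact .inl ⟨w, hu, hvu⟩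
    | ofRight w hw =>
      rw [dot_adj_ofLeft_ofRight hw] at hvu
      exact .inr ⟨hvu.1, w, hu, hvu.2⟩
  · rintro (⟨w, hw, hvw⟩ | ⟨rfl, w, hw, hvw⟩)
    · exact ⟨_, hw, hvw⟩
    · exact ⟨_, hw, by rwa [← ofRight_left, dot_adj_ofRight_ofRight]⟩

lemma dominates_ofRight_iff {S : Set (X.dot Y).V} {w : Y.V} (hw : w ≠ Y.left) :
    Dominates (X.dot Y).graph S (ofRight X Y w) ↔ Dominates Y.graph (ofRight X Y ⁻¹' S) w := by
  constructor
  · rintro ⟨u, hu, hwu⟩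
    induction u using dot_cases with
    | ofLeft v =>
      rw [SimpleGraph.adj_comm, dot_adj_ofLeft_ofRight hw] at hwu
      obtain ⟨rfl, hwu⟩ := hwu
      exact ⟨Y.left, by rwa [Set.mem_preimage, ofRight_left], hwu.symm⟩
    | ofRight v _ => exact ⟨v, hu, dot_adj_ofRight_ofRight.1 hwu⟩
  · rintro ⟨v, hv, hwv⟩
    exact ⟨_, hv, dot_adj_ofRight_ofRight.2 hwv⟩

/-- The vertex `v` is dominated by `S`, where the marked vertices may also be dominated from outside
`X`: the left vertex if `a` holds, the right vertex if `b` holds. -/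
def Covered (X : PointedGraph.{u}) (a b : Prop) (S : Set X.V) (v : X.V) : Prop :=
  Dominates X.graph S v ∨ a ∧ v = X.left ∨ b ∧ v = X.right

lemma Covered.mono {a' b' : Prop} {S : Set X.V} {v : X.V} (h : X.Covered a b S v) (ha : a → a')
    (hb : b → b') : X.Covered a' b' S v :=
  h.imp_right (Or.imp (And.imp_left ha) (And.imp_left hb))

lemma covered_false_false {S : Set X.V} {v : X.V} :
    X.Covered False False S v ↔ Dominates X.graph S v := by
  simp [Covered]

lemma covered_ofLeft_iff {S : Set (X.dot Y).V} {v : X.V} (hv : v ≠ X.right) :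
    (X.dot Y).Covered a b S (ofLeft X Y v) ↔ X.Covered a c (ofLeft X Y ⁻¹' S) v := by
  have hleft : ofLeft X Y v = (X.dot Y).left ↔ v = X.left := ofLeft_injective.eq_iff
  simp [Covered, dominates_ofLeft_iff, hleft, dot_right, ofLeft_eq_ofRight_iff, hv]

lemma covered_ofRight_iff {S : Set (X.dot Y).V} {w : Y.V} (hw : w ≠ Y.left) :
    (X.dot Y).Covered a b S (ofRight X Y w) ↔ Y.Covered c b (ofRight X Y ⁻¹' S) w := by
  have hleft : ofRight X Y w ≠ (X.dot Y).left := fun h => hw (ofLeft_eq_ofRight_iff.1 h.symm).2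
  simp [Covered, dominates_ofRight_iff hw, hleft, dot_right, ofRight_injective.eq_iff, hw]

lemma covered_ofLeft_right_iff {S : Set (X.dot Y).V} :
    (X.dot Y).Covered a b S (ofLeft X Y X.right) ↔
      X.Covered a False (ofLeft X Y ⁻¹' S) X.right ∨
        Y.Covered False b (ofRight X Y ⁻¹' S) Y.left := by
  have hleft : ofLeft X Y X.right = (X.dot Y).left ↔ X.right = X.left := ofLeft_injective.eq_iff
  simp only [Covered, dominates_ofLeft_iff, hleft, dot_right, ofLeft_eq_ofRight_iff]
  tauto

/-- Every total dominating set `S` of `X` has at least `j + 1` vertices. More generally, if the left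
or the right vertex is dominated from outside `X` (as `a` and `b` say), then each of these two that
`S` does not contain lowers the bound by one. -/
def LowerBound (X : PointedGraph.{u}) (j : ℕ) : Prop :=
  ∀ (S : Set X.V) (a b : Prop), (∀ v, X.Covered a b S v) →
    (j + iverson (X.left ∈ S ∨ ¬ a) + iverson (X.right ∈ S ∨ ¬ b) : ℕ) ≤ S.encard + 1

lemma lowerBound_of_dominates {V : Type u} {G : SimpleGraph V} {s t : V} {j : ℕ}
    (h : ∀ S, (∀ v, v ≠ s → v ≠ t → Dominates G S v) →
      (j + iverson (s ∈ S ∨ Dominates G S s) + iverson (t ∈ S ∨ Dominates G S t) : ℕ) ≤ S.encard)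
    (hst : s ≠ t) :
    LowerBound ⟨V, G, s, t⟩ (j + 1) := by
  intro (S : Set V) a b hS
  have hiv {p q : Prop} (hpq : p → q) : iverson p ≤ iverson q := by
    unfold iverson; split_ifs <;> simp_all
  have hleft : iverson (s ∈ S ∨ ¬ a) ≤ iverson (s ∈ S ∨ Dominates G S s) :=
    hiv (Or.imp_right fun ha => by simpa [Covered, ha, hst] using hS s)
  have hright : iverson (t ∈ S ∨ ¬ b) ≤ iverson (t ∈ S ∨ Dominates G S t) :=
    hiv (Or.imp_right fun hb => by simpa [Covered, hb, hst.symm] using hS t)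
  have hS' := h S fun v hl hr => by simpa [Covered, hl, hr] using hS v
  change ((j + 1 + iverson (s ∈ S ∨ ¬ a) + iverson (t ∈ S ∨ ¬ b) : ℕ) : ℕ∞) ≤ S.encard + 1
  generalize S.encard = c at hS' ⊢
  enat_to_nat
  omega

lemma lowerBound_point : LowerBound point.{u} 0 := by
  intro S a b hS
  have hab : a ∨ b := by simpa [Covered, Dominates, point] using hS point.left
  have hcard : S.encard = iverson (point.left ∈ S) := by
    have : Subsingleton point.V := inferInstanceAs (Subsingleton PUnit)
    rcases S.eq_empty_or_singleton_of_subsingleton with rfl | ⟨u, rfl⟩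
    · simp [iverson]
    · simp [iverson, Subsingleton.elim point.left u]
  change ((0 + iverson (point.left ∈ S ∨ ¬ a) + iverson (point.left ∈ S ∨ ¬ b) : ℕ) : ℕ∞) ≤ _
  rw [hcard]
  norm_cast
  unfold iverson
  split_ifs <;> simp_all

lemma LowerBound.dot {j k : ℕ} (hX : LowerBound X j) (hY : LowerBound Y k) :
    LowerBound (X.dot Y) (j + k) := by
  intro S a b hS
  let c := X.Covered a False (ofLeft X Y ⁻¹' S) X.right
  have hcut : ¬ c → Y.Covered False b (ofRight X Y ⁻¹' S) Y.left :=
    (covered_ofLeft_right_iff.1 (hS _)).resolve_left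
  have hSX := hX (ofLeft X Y ⁻¹' S) a (¬ c) fun v => by
    by_cases hv : v = X.right
    · by_cases hc : c
      · exact hv ▸ hc.mono id False.elim
      · exact .inr (.inr ⟨hc, hv⟩)
    · exact (covered_ofLeft_iff hv).1 (hS _)
  have hSY := hY (ofRight X Y ⁻¹' S) c b fun w => by
    by_cases hw : w = Y.left
    · by_cases hc : c
      · exact .inr (.inl ⟨hc, hw⟩)
      · exact hw ▸ (hcut hc).mono False.elim id
    · exact (covered_ofRight_iff hw).1 (hS _)
  have htelescope : iverson (ofLeft X Y X.right ∈ S ∨ ¬¬c) + iverson (ofLeft X Y X.right ∈ S ∨ ¬c) =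
      iverson (ofLeft X Y X.right ∈ S) + 1 := by
    unfold iverson; split_ifs <;> simp_all
  have hcard := encard_preimage_add_encard_preimage S
  simp only [Set.mem_preimage, ofRight_left] at hSX hSY
  change ((j + k + iverson (ofLeft X Y X.left ∈ S ∨ ¬ a) +
    iverson (ofRight X Y Y.right ∈ S ∨ ¬ b) : ℕ) : ℕ∞) ≤ _
  generalize S.encard = s, (ofLeft X Y ⁻¹' S).encard = t, (ofRight X Y ⁻¹' S).encard = r
    at hcard hSX hSY ⊢
  enat_to_nat
  · exact absurd (hcard.symm.trans (add_top _)) (ENat.natCast_ne_top _)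
  · omega

/-- Apart from the vertices in `D`, every vertex is dominated by `S` or is a marked vertex that `S`
contains and that may be left undominated: the left one if `el` holds, the right one if `er`
holds. -/
def IsCover (X : PointedGraph.{u}) (el er : Prop) (D S : Set X.V) : Prop :=
  ∀ v ∉ D, X.Covered (el ∧ X.left ∈ S) (er ∧ X.right ∈ S) S v

/-- `X` has total dominating sets as small as vertex-criticality with `γ_t = j + 1` demands: ones
with `j` vertices for `X - v`, and ones with `j + 1` vertices for `X` through each marked vertex.
The flags `el` and `er` relax this to the extent that the factors of a product may help each other:
a marked vertex that belongs to the set, but is not the one it is required to go through, need not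
be dominated. -/
structure UpperBound (el er : Prop) (X : PointedGraph.{u}) (j : ℕ) : Prop where
  erase : ∀ v, ∃ S : Set X.V, v ∉ S ∧ S.encard ≤ j ∧ X.IsCover el er {v} S
  left_mem : ∃ S : Set X.V, X.left ∈ S ∧ S.encard ≤ (j + 1 : ℕ) ∧ X.IsCover False er ∅ S
  right_mem : ∃ S : Set X.V, X.right ∈ S ∧ S.encard ≤ (j + 1 : ℕ) ∧ X.IsCover el False ∅ S

variable {el er el' er' : Prop} {i j k : ℕ}

lemma IsCover.mono {D S : Set X.V} (h : X.IsCover el er D S) (hl : el → el') (hr : er → er') :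
    X.IsCover el' er' D S :=
  fun v hv => (h v hv).mono (And.imp_left hl) (And.imp_left hr)

lemma UpperBound.mono (h : UpperBound el er X j) (hl : el → el') (hr : er → er') :
    UpperBound el' er' X j where
  erase v := let ⟨S, hv, hS, hc⟩ := h.erase v; ⟨S, hv, hS, hc.mono hl hr⟩
  left_mem := let ⟨S, hv, hS, hc⟩ := h.left_mem; ⟨S, hv, hS, hc.mono id hr⟩
  right_mem := let ⟨S, hv, hS, hc⟩ := h.right_mem; ⟨S, hv, hS, hc.mono hl id⟩

lemma upperBound_point : UpperBound True True point.{u} 0 where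
  erase v := ⟨∅, by simp, by simp, fun w hw => absurd rfl hw⟩
  left_mem := ⟨{point.left}, rfl, (Set.encard_singleton _).le,
    fun _ _ => .inr (.inr ⟨⟨trivial, rfl⟩, rfl⟩)⟩
  right_mem := ⟨{point.right}, rfl, (Set.encard_singleton _).le,
    fun _ _ => .inr (.inl ⟨⟨trivial, rfl⟩, rfl⟩)⟩

lemma upperBound_of_lists {V : Type u} {G : SimpleGraph V} {s t : V}
    (erase : ∀ u, ∃ l : List V, u ∉ l ∧ l.length ≤ j ∧ ∀ v ≠ u,
      (∃ w ∈ l, G.Adj v w) ∨ (el ∧ s ∈ l) ∧ v = s ∨ (er ∧ t ∈ l) ∧ v = t)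
    (left_mem : ∃ l : List V, s ∈ l ∧ l.length ≤ j + 1 ∧ ∀ v,
      (∃ w ∈ l, G.Adj v w) ∨ (er ∧ t ∈ l) ∧ v = t)
    (right_mem : ∃ l : List V, t ∈ l ∧ l.length ≤ j + 1 ∧ ∀ v,
      (∃ w ∈ l, G.Adj v w) ∨ (el ∧ s ∈ l) ∧ v = s) :
    UpperBound el er ⟨V, G, s, t⟩ j where
  erase v := let ⟨l, hv, hl, hc⟩ := erase v
    ⟨_, hv, (encard_setOf_mem_list_le l).trans (by exact_mod_cast hl), hc⟩
  left_mem := let ⟨l, hv, hl, hc⟩ := left_mem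
    ⟨_, hv, (encard_setOf_mem_list_le l).trans (by exact_mod_cast hl),
      fun v _ => (hc v).imp_right .inr⟩
  right_mem := let ⟨l, hv, hl, hc⟩ := right_mem
    ⟨_, hv, (encard_setOf_mem_list_le l).trans (by exact_mod_cast hl),
      fun v _ => (hc v).imp_right .inl⟩

/-- The set of vertices of `X • Y` given by a set of vertices of `X` and a set of vertices of `Y`;
it is meant for sets that agree at the common vertex, where `S` decides. -/
def glue (S : Set X.V) (T : Set Y.V) : Set (X.dot Y).V :=
  {u | Sum.elim (· ∈ S) (·.1 ∈ T) u}

lemma preimage_ofLeft_glue {S : Set X.V} {T : Set Y.V} : ofLeft X Y ⁻¹' glue S T = S := rfl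

lemma preimage_ofRight_glue {S : Set X.V} {T : Set Y.V} (h : Y.left ∈ T ↔ X.right ∈ S) :
    ofRight X Y ⁻¹' glue S T = T := by
  ext w
  rw [Set.mem_preimage]
  by_cases hw : w = Y.left
  · rw [hw, ofRight_left, h]
    exact Iff.rfl
  · rw [ofRight_of_ne hw]
    exact Iff.rfl

lemma encard_add_encard_eq_encard_glue {S : Set X.V} {T : Set Y.V} (h : Y.left ∈ T ↔ X.right ∈ S) :
    S.encard + T.encard = (glue S T).encard + iverson (X.right ∈ S) := by
  have hcard := encard_preimage_add_encard_preimage (glue S T)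
  rwa [preimage_ofLeft_glue, preimage_ofRight_glue h] at hcard

lemma isCover_glue {S : Set X.V} {T : Set Y.V} {D : Set (X.dot Y).V}
    (h : Y.left ∈ T ↔ X.right ∈ S)
    (hS : ∀ v ≠ X.right, ofLeft X Y v ∉ D → X.Covered (el ∧ X.left ∈ S) a S v)
    (hT : ∀ w ≠ Y.left, ofRight X Y w ∉ D → Y.Covered b (er ∧ Y.right ∈ T) T w)
    (hcut : ofLeft X Y X.right ∉ D →
      X.Covered (el ∧ X.left ∈ S) False S X.right ∨ Y.Covered False (er ∧ Y.right ∈ T) T Y.left) :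
    (X.dot Y).IsCover el er D (glue S T) := by
  have hright : (X.dot Y).right ∈ glue S T ↔ Y.right ∈ T :=
    Set.ext_iff.1 (preimage_ofRight_glue h) Y.right
  intro u hu
  rw [hright]
  induction u using dot_cases with
  | ofLeft v =>
    by_cases hv : v = X.right
    · subst hv
      rw [covered_ofLeft_right_iff, preimage_ofRight_glue h]
      exact hcut hu
    · exact (covered_ofLeft_iff hv).2 (hS v hv hu)
  | ofRight w hw =>
    rw [covered_ofRight_iff hw, preimage_ofRight_glue h]
    exact hT w hw hu

lemma UpperBound.exists_left_mem_iff (hY : UpperBound True er Y k) (P : Prop) :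
    ∃ T : Set Y.V, (Y.left ∈ T ↔ P) ∧ T.encard ≤ (k + iverson P : ℕ) ∧
      Y.IsCover True er {Y.left} T ∧ (P → Y.Covered False (er ∧ Y.right ∈ T) T Y.left) := by
  by_cases hP : P
  · obtain ⟨T, hl, hT, hc⟩ := hY.left_mem
    exact ⟨T, by simp [hl, hP], by simpa [iverson, hP] using hT,
      fun v _ => (hc.mono False.elim id) v (Set.notMem_empty v),
      fun _ => (hc _ (Set.notMem_empty _)).mono And.left id⟩
  · obtain ⟨T, hl, hT, hc⟩ := hY.erase Y.left
    exact ⟨T, by simp [hl, hP], by simpa [iverson, hP] using hT, hc, fun h => absurd h hP⟩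

lemma UpperBound.exists_right_mem_iff (hX : UpperBound el True X j) (P : Prop) :
    ∃ S : Set X.V, (X.right ∈ S ↔ P) ∧ S.encard ≤ (j + iverson P : ℕ) ∧
      X.IsCover el True {X.right} S ∧ (P → X.Covered (el ∧ X.left ∈ S) False S X.right) := by
  by_cases hP : P
  · obtain ⟨S, hr, hS, hc⟩ := hX.right_mem
    exact ⟨S, by simp [hr, hP], by simpa [iverson, hP] using hS,
      fun v _ => (hc.mono id False.elim) v (Set.notMem_empty v),
      fun _ => (hc _ (Set.notMem_empty _)).mono id And.left⟩
  · obtain ⟨S, hr, hS, hc⟩ := hX.erase X.right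
    exact ⟨S, by simp [hr, hP], by simpa [iverson, hP] using hS, hc, fun h => absurd h hP⟩

lemma UpperBound.exists_glue_left (hY : UpperBound True er Y k) {S : Set X.V} {D : Set (X.dot Y).V}
    (hSi : S.encard ≤ i) (hS : X.IsCover el' True (ofLeft X Y ⁻¹' D) S) :
    ∃ T : Set Y.V, (Y.left ∈ T ↔ X.right ∈ S) ∧ (glue S T).encard ≤ (i + k : ℕ) ∧
      (X.dot Y).IsCover el' er D (glue S T) := by
  obtain ⟨T, hST, hTk, hT, hTleft⟩ := hY.exists_left_mem_iff (X.right ∈ S)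
  have hcard := encard_add_encard_eq_encard_glue hST
  refine ⟨T, hST, ?_, isCover_glue hST (fun v _ hv => hS v hv) (fun w hw _ => hT w hw) fun hD => ?_⟩
  · generalize S.encard = s, T.encard = t, (glue S T).encard = r at hcard hSi hTk ⊢
    enat_to_nat
    omega
  · by_cases hr : X.right ∈ S
    · exact .inr (hTleft hr)
    · exact .inl ((hS _ hD).mono id fun h => hr h.2)

lemma UpperBound.exists_glue_right (hX : UpperBound el True X j) {T : Set Y.V} {D : Set (X.dot Y).V}
    (hTi : T.encard ≤ i) (hT : Y.IsCover True er' (ofRight X Y ⁻¹' D) T) :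
    ∃ S : Set X.V, (Y.left ∈ T ↔ X.right ∈ S) ∧ (glue S T).encard ≤ (j + i : ℕ) ∧
      (X.dot Y).IsCover el er' D (glue S T) := by
  obtain ⟨S, hST, hSj, hS, hSright⟩ := hX.exists_right_mem_iff (Y.left ∈ T)
  have hcard := encard_add_encard_eq_encard_glue hST.symm
  rw [hST] at hcard
  refine ⟨S, hST.symm, ?_, isCover_glue hST.symm (fun v hv _ => hS v hv) (fun w _ hw => hT w hw)
    fun hD => ?_⟩
  · generalize S.encard = s, T.encard = t, (glue S T).encard = r at hcard hTi hSj ⊢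
    enat_to_nat
    omega
  · by_cases hl : Y.left ∈ T
    · exact .inl (hSright hl)
    · exact .inr ((hT _ (by rwa [Set.mem_preimage, ofRight_left])).mono (fun h => hl h.2) id)

lemma UpperBound.dot (hX : UpperBound el True X j) (hY : UpperBound True er Y k) :
    UpperBound el er (X.dot Y) (j + k) where
  erase u := by
    induction u using dot_cases with
    | ofLeft v =>
      obtain ⟨S, hv, hSj, hS⟩ := hX.erase v
      obtain ⟨T, -, hcard, hcover⟩ := hY.exists_glue_left (D := {ofLeft X Y v}) hSj
        (by rwa [← Set.image_singleton, ofLeft_injective.preimage_image])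
      exact ⟨glue S T, hv, hcard, hcover⟩
    | ofRight w _ =>
      obtain ⟨T, hw, hTk, hT⟩ := hY.erase w
      obtain ⟨S, hST, hcard, hcover⟩ := hX.exists_glue_right (D := {ofRight X Y w}) hTk
        (by rwa [← Set.image_singleton, ofRight_injective.preimage_image])
      exact ⟨glue S T, fun h => hw ((Set.ext_iff.1 (preimage_ofRight_glue hST) w).1 h), hcard,
        hcover⟩
  left_mem := by
    obtain ⟨S, hl, hSj, hS⟩ := hX.left_mem
    obtain ⟨T, -, hcard, hcover⟩ := hY.exists_glue_left (D := ∅) hSj hS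
    exact ⟨glue S T, hl, by rwa [add_right_comm], hcover⟩
  right_mem := by
    obtain ⟨T, hr, hTk, hT⟩ := hY.right_mem
    obtain ⟨S, hST, hcard, hcover⟩ := hX.exists_glue_right (D := ∅) hTk hT
    exact ⟨glue S T, (Set.ext_iff.1 (preimage_ofRight_glue hST) Y.right).2 hr, hcard, hcover⟩

lemma isKVertexCritical_of_bounds (hl : LowerBound X j) (hu : UpperBound False False X j) :
    IsKVertexCritical X.graph (j + 1) := by
  have hdom {D S : Set X.V} (hS : X.IsCover False False D S) : ∀ v ∉ D, Dominates X.graph S v :=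
    fun v hv => covered_false_false.1 ((hS v hv).mono And.left And.left)
  have hle : totalDominationNumber X.graph ≤ (j + 1 : ℕ) := by
    obtain ⟨S, -, hS, hc⟩ := hu.left_mem
    exact iInf_le_of_le ⟨S, fun v => hdom hc v (Set.notMem_empty v)⟩ hS
  have hge : (j + 1 : ℕ) ≤ totalDominationNumber X.graph := by
    refine le_iInf fun ⟨S, hS⟩ => ?_
    have h := hl S False False fun v => covered_false_false.2 (hS v)
    simp only [iverson, not_false_eq_true, or_true, if_true] at h
    push_cast at h ⊢
    exact (ENat.add_le_add_iff_right ENat.one_ne_top).1 h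
  refine ⟨fun v _ => ?_, hle.antisymm hge⟩
  obtain ⟨S, hv, hSj, hc⟩ := hu.erase v
  have hS : IsTotalDominating (removeVertex X.graph v) (Subtype.val ⁻¹' S) := by
    rintro ⟨w, hw⟩
    obtain ⟨s, hs, hws⟩ := hdom hc w hw
    exact ⟨⟨s, fun h => hv (h ▸ hs)⟩, hs, hws⟩
  calc totalDominationNumber (removeVertex X.graph v)
      ≤ (Subtype.val ⁻¹' S : Set ({v}ᶜ : Set X.V)).encard := iInf_le_of_le ⟨_, hS⟩ le_rfl
    _ ≤ S.encard := by
      rw [← Subtype.val_injective.encard_image]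
      exact Set.encard_mono (Set.image_preimage_subset _ _)
    _ ≤ j := hSj
    _ < (j + 1 : ℕ) := by exact_mod_cast j.lt_succ_self
    _ ≤ totalDominationNumber X.graph := hge

lemma ediam_dot_le {k ℓ : ℕ} (hX : X.graph.ediam ≤ k) (hY : Y.graph.ediam ≤ ℓ) :
    (X.dot Y).graph.ediam ≤ (k + ℓ : ℕ) := by
  have hleft (v w : X.V) : (X.dot Y).graph.edist (ofLeft X Y v) (ofLeft X Y w) ≤ k :=
    (edist_map_le (⟨ofLeft X Y, id⟩ : X.graph →g (X.dot Y).graph) v w).trans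
      (SimpleGraph.edist_le_ediam.trans hX)
  have hright (v w : Y.V) : (X.dot Y).graph.edist (ofRight X Y v) (ofRight X Y w) ≤ ℓ :=
    (edist_map_le (⟨ofRight X Y, dot_adj_ofRight_ofRight.2⟩ : Y.graph →g (X.dot Y).graph) v w).trans
      (SimpleGraph.edist_le_ediam.trans hY)
  have hacross (v : X.V) (w : Y.V) :
      (X.dot Y).graph.edist (ofLeft X Y v) (ofRight X Y w) ≤ (k + ℓ : ℕ) :=
    calc _ ≤ (X.dot Y).graph.edist (ofLeft X Y v) (ofLeft X Y X.right) +
          (X.dot Y).graph.edist (ofRight X Y Y.left) (ofRight X Y w) := by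
            rw [ofRight_left]
            exact SimpleGraph.edist_triangle
      _ ≤ (k + ℓ : ℕ) := by
        push_cast
        exact add_le_add (hleft _ _) (hright _ _)
  refine SimpleGraph.ediam_le_of_edist_le fun u v => ?_
  induction u using dot_cases with
  | ofLeft u =>
    induction v using dot_cases with
    | ofLeft v => exact (hleft u v).trans (by exact_mod_cast Nat.le_add_right k ℓ)
    | ofRight v _ => exact hacross u v
  | ofRight u _ =>
    induction v using dot_cases with
    | ofLeft v => exact SimpleGraph.edist_comm.trans_le (hacross v u)
    | ofRight v _ => exact (hright u v).trans (by exact_mod_cast Nat.le_add_left ℓ k)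

lemma ediam_point_le : point.{u}.graph.ediam ≤ (0 : ℕ) :=
  SimpleGraph.ediam_le_of_edist_le fun _ _ => (SimpleGraph.edist_self).le

/-- There is a level function on `X` that takes the value `0` at the left vertex and `ℓ` at the
right one and does not grow by more than one along an edge; so the two vertices have distance at
least `ℓ`. -/
def HasLevels (X : PointedGraph.{u}) (ℓ : ℕ) : Prop :=
  ∃ f : X.V → ℕ, f X.left = 0 ∧ f X.right = ℓ ∧ ∀ v w, X.graph.Adj v w → f w ≤ f v + 1

lemma hasLevels_point : HasLevels point.{u} 0 := ⟨fun _ => 0, rfl, rfl, fun _ _ _ => zero_le_one⟩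

lemma HasLevels.dot {k ℓ : ℕ} (hX : HasLevels X k) (hY : HasLevels Y ℓ) :
    HasLevels (X.dot Y) (k + ℓ) := by
  obtain ⟨f, hf0, hfk, hf⟩ := hX
  obtain ⟨g, hg0, hgℓ, hg⟩ := hY
  let h : (X.dot Y).V → ℕ := Sum.elim f fun w => k + g w.1
  have hright (w : Y.V) : h (ofRight X Y w) = k + g w := by
    by_cases hw : w = Y.left
    · rw [hw, ofRight_left, hg0]
      exact hfk
    · rw [ofRight_of_ne hw]
      rfl
  have hcut {v w} (hv : v = X.right) (hw : Y.graph.Adj Y.left w) :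
      h (ofRight X Y w) ≤ f v + 1 ∧ f v ≤ h (ofRight X Y w) + 1 := by
    have := hg _ _ hw
    rw [hright, hv, hfk]
    omega
  refine ⟨h, hf0, by rw [dot_right, hright, hgℓ], fun u v huv => ?_⟩
  induction u using dot_cases with
  | ofLeft u =>
    induction v using dot_cases with
    | ofLeft v => exact hf u v huv
    | ofRight v hv =>
      obtain ⟨hu, huv⟩ := (dot_adj_ofLeft_ofRight hv).1 huv
      exact (hcut hu huv).1
  | ofRight u hu =>
    induction v using dot_cases with
    | ofLeft v =>
      obtain ⟨hv, huv⟩ := (dot_adj_ofLeft_ofRight hu).1 huv.symm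
      exact (hcut hv huv).2
    | ofRight v _ =>
      rw [hright, hright]
      have := hg _ _ (dot_adj_ofRight_ofRight.1 huv)
      omega

lemma diam_eq {ℓ : ℕ} (hd : X.graph.ediam ≤ ℓ) (hl : HasLevels X ℓ) : X.graph.diam = ℓ := by
  obtain ⟨f, hf0, hfℓ, hf⟩ := hl
  have hge : (ℓ : ℕ∞) ≤ X.graph.edist X.left X.right := le_iInf fun p => by
    simpa [hf0, hfℓ] using le_add_length_of_adj hf p
  rw [SimpleGraph.diam, hd.antisymm (hge.trans SimpleGraph.edist_le_ediam)]
  exact ENat.toNat_natCast ℓ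

lemma dotPow_of_dot {P : PointedGraph.{u} → ℕ → Prop} (hpoint : P point 0)
    (hdot : ∀ {X Y j k}, P X j → P Y k → P (X.dot Y) (j + k)) (h : P X j) :
    ∀ n, P (X.dotPow n) (j * n)
  | 0 => hpoint
  | 1 => by simpa [dotPow] using h
  | n + 2 => hdot (dotPow_of_dot hpoint hdot h (n + 1)) h

end Product

section R

variable {m : ℕ} {i j : Fin (2 * m)} {v w : RVertex.{u} m}

/-- The graph `R`, with its vertex type displayed as `RVertex m`. -/
def rGraph (m : ℕ) : SimpleGraph (RVertex.{u} m) := (graphR m).graph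

lemma rGraph_adj_iff : (rGraph m).Adj v w ↔ v ≠ w ∧ (RRel m v w ∨ RRel m w v) := Iff.rfl

lemma graphF_adj_iff : (graphF m).Adj i j ↔
    i.val % 2 ≠ j.val % 2 ∧ ¬ (IsFirst i ∧ IsLast j) ∧ ¬ (IsLast i ∧ IsFirst j) := Iff.rfl

lemma graphK_adj_iff : (graphK m).Adj i j ↔ i.val % 2 ≠ j.val % 2 := Iff.rfl

lemma rGraph_adj_left_iff : (rGraph m).Adj .left v ↔ ∃ i, v = .x i := by
  cases v <;> simp [rGraph_adj_iff, RRel]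

lemma rGraph_adj_right_iff : (rGraph m).Adj .right v ↔ v = .z₂ ∨ ∃ i, v = .y i := by
  cases v <;> simp [rGraph_adj_iff, RRel]

lemma rGraph_adj_z₃_iff : (rGraph m).Adj .z₃ v ↔ v = .z₁ ∨ ∃ i, v = .y i := by
  cases v <;> simp [rGraph_adj_iff, RRel]

attribute [local simp] rGraph_adj_iff RRel graphF_adj_iff graphK_adj_iff IsFirst IsLast Fin.ext_iff

lemma exists_not_rGraph_adj {d : RVertex.{u} m} (hd : d = .left ∨ ∃ i, d = .x i) (j : Fin (2 * m)) :
    ∃ v : RVertex.{u} m, v ≠ .left ∧ v ≠ .right ∧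
      ¬ (rGraph m).Adj v d ∧ ¬ (rGraph m).Adj v (.y j) := by
  rcases hd with rfl | ⟨i, rfl⟩
  · exact ⟨.y j, nofun, nofun, by simp, by simp⟩
  by_contra! h
  have hxj := h (.x j)
  have hyi := h (.y i)
  have hz₁ := h .z₁
  have hz₂ := h .z₂
  simp at hxj hyi hz₁ hz₂
  omega

lemma lowerBound_graphR : LowerBound (graphR.{u} m) 2 := by
  refine lowerBound_of_dominates (G := rGraph m) (s := .left) (t := .right) (fun S hS => ?_) nofun
  obtain ⟨a, haS, ha⟩ := hS .z₃ nofun nofun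
  rw [rGraph_adj_z₃_iff] at ha
  have hleft (h : .left ∈ S ∨ Dominates (rGraph m) S .left) :
      ∃ d ∈ S, d = .left ∨ ∃ i, d = .x i := by
    simpa only [mem_or_dominates_iff, rGraph_adj_left_iff] using h
  have hright (h : .right ∈ S ∨ Dominates (rGraph m) S .right) :
      ∃ b ∈ S, b = .right ∨ b = .z₂ ∨ ∃ i, b = .y i := by
    simpa only [mem_or_dominates_iff, rGraph_adj_right_iff] using h
  by_cases hL : .left ∈ S ∨ Dominates (rGraph m) S .left <;>
    by_cases hR : .right ∈ S ∨ Dominates (rGraph m) S .right <;>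
    simp only [iverson, hL, hR, if_true, if_false]
  · obtain ⟨d, hdS, hd⟩ := hleft hL
    obtain ⟨b, hbS, hb⟩ := hright hR
    rcases ha with rfl | ⟨j, rfl⟩
    · exact length_le_encard (l := [d, .z₁, b])
        (by rcases hd with rfl | ⟨i, rfl⟩ <;> rcases hb with rfl | rfl | ⟨k, rfl⟩ <;> simp)
        (by simp [*])
    · obtain ⟨v, hvl, hvr, hvd, hvj⟩ := exists_not_rGraph_adj hd j
      exact length_add_one_le_encard (l := [d, .y j]) (by rcases hd with rfl | ⟨i, rfl⟩ <;> simp)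
        (by simp [hdS, haS]) (hS v hvl hvr) (by simp [hvd, hvj, -rGraph_adj_iff])
  · obtain ⟨d, hdS, hd⟩ := hleft hL
    exact length_le_encard (l := [d, a])
      (by rcases hd with rfl | ⟨i, rfl⟩ <;> rcases ha with rfl | ⟨j, rfl⟩ <;> simp) (by simp [*])
  · obtain ⟨b, hbS, hb⟩ := hright hR
    rcases ha with rfl | ⟨j, rfl⟩
    · exact length_le_encard (l := [.z₁, b])
        (by rcases hb with rfl | rfl | ⟨i, rfl⟩ <;> simp) (by simp [*])
    · exact length_add_one_le_encard (l := [.y j]) (by simp) (by simpa) (hS (.y j) nofun nofun)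
        (by simp)
  · exact length_le_encard (l := [a]) (by simp) (by simpa)

lemma exists_pair_dominating_compl_x (hm : 2 ≤ m) (i : Fin (2 * m)) :
    ∃ a b : RVertex.{u} m, .x i ≠ a ∧ .x i ≠ b ∧
      ∀ v ≠ .x i, (rGraph m).Adj v a ∨ (rGraph m).Adj v b := by
  obtain ⟨k, hk₀, hk₁, hki⟩ : ∃ k : Fin (2 * m), ¬ IsFirst k ∧ ¬ IsLast k ∧
      k.val % 2 ≠ i.val % 2 := by
    rcases Nat.mod_two_eq_zero_or_one i.val with hi | hi
    · exact ⟨⟨1, by omega⟩, by simp, by simp; omega, by simp [hi]⟩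
    · exact ⟨⟨2, by omega⟩, by simp, by simp; omega, by simp [hi]⟩
  refine ⟨.x k, .y i, by rintro ⟨⟩; exact hki rfl, nofun, ?_⟩
  rintro (_ | _ | _ | _ | _ | v | v) hv <;> simp at * <;> omega

lemma exists_pair_dominating_compl_y (hm : 2 ≤ m) (i : Fin (2 * m)) :
    ∃ a b : RVertex.{u} m, .y i ≠ a ∧ .y i ≠ b ∧
      ∀ v ≠ .y i, (rGraph m).Adj v a ∨ (rGraph m).Adj v b := by
  obtain ⟨k, hk, hki, hkm⟩ : ∃ k : Fin (2 * m), k ≠ i ∧ k.val % 2 = i.val % 2 ∧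
      (IsFirst i ∨ IsLast i → ¬ IsFirst k ∧ ¬ IsLast k) := by
    rcases Nat.mod_two_eq_zero_or_one i.val with hi | hi
    · refine ⟨⟨if i.val = 0 then 2 else 0, by split_ifs <;> omega⟩, ?_⟩
      split_ifs <;> simp <;> omega
    · refine ⟨⟨if i.val = 1 then 2 * m - 1 else 1, by split_ifs <;> omega⟩, ?_⟩
      split_ifs <;> simp <;> omega
  refine ⟨.x i, .y k, nofun, by rintro ⟨⟩; exact hk rfl, ?_⟩
  rintro (_ | _ | _ | _ | _ | v | v) hv <;> simp at * <;> omega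

lemma exists_pair_dominating_compl (hm : 2 ≤ m) (u : RVertex.{u} m) :
    ∃ a b : RVertex.{u} m, u ≠ a ∧ u ≠ b ∧ ∀ v ≠ u, (rGraph m).Adj v a ∨ (rGraph m).Adj v b := by
  let k₀ : Fin (2 * m) := ⟨0, by omega⟩
  let k₁ : Fin (2 * m) := ⟨1, by omega⟩
  let k₂ : Fin (2 * m) := ⟨2, by omega⟩
  let k : Fin (2 * m) := ⟨2 * m - 1, by omega⟩
  rcases u with _ | _ | _ | _ | _ | i | i
  case x => exact exists_pair_dominating_compl_x hm i
  case y => exact exists_pair_dominating_compl_y hm i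
  case left =>
    refine ⟨.y k₀, .y k₁, nofun, nofun, ?_⟩
    rintro (_ | _ | _ | _ | _ | v | v) hv <;> simp [k₀, k₁] at hv ⊢ <;> omega
  case right =>
    refine ⟨.x k₁, .z₁, nofun, nofun, ?_⟩
    rintro (_ | _ | _ | _ | _ | v | v) hv <;> simp [k₁] at hv ⊢ <;> omega
  case z₁ =>
    refine ⟨.x k, .y k₀, nofun, nofun, ?_⟩
    rintro (_ | _ | _ | _ | _ | v | v) hv <;> simp [k₀, k] at hv ⊢ <;> omega
  case z₂ =>
    refine ⟨.x k₀, .y k, nofun, nofun, ?_⟩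
    rintro (_ | _ | _ | _ | _ | v | v) hv <;> simp [k₀, k] at hv ⊢ <;> omega
  case z₃ =>
    refine ⟨.x k₂, .z₂, nofun, nofun, ?_⟩
    rintro (_ | _ | _ | _ | _ | v | v) hv <;> simp [k₂] at hv ⊢ <;> omega

lemma upperBound_graphR (hm : 2 ≤ m) : UpperBound False False (graphR.{u} m) 2 := by
  let k₀ : Fin (2 * m) := ⟨0, by omega⟩
  let k₁ : Fin (2 * m) := ⟨1, by omega⟩
  let k₂ : Fin (2 * m) := ⟨2, by omega⟩
  refine upperBound_of_lists (G := rGraph m) (fun u => ?_) ?_ ?_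
  · obtain ⟨a, b, ha, hb, hab⟩ := exists_pair_dominating_compl hm u
    exact ⟨[a, b], by simp [ha, hb], le_rfl, fun v hv => .inl (by simpa using hab v hv)⟩
  · refine ⟨[.left, .x k₀, .y k₁], by simp, le_rfl, ?_⟩
    rintro (_ | _ | _ | _ | _ | v | v) <;> simp [k₀, k₁] <;> omega
  · refine ⟨[.right, .x k₀, .y k₂], by simp, le_rfl, ?_⟩
    rintro (_ | _ | _ | _ | _ | v | v) <;> simp [k₀, k₂] <;> omega

lemma hasLevels_graphR : HasLevels (graphR.{u} m) 3 := by
  let f : RVertex.{u} m → ℕ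
    | .left => 0
    | .x _ => 1
    | .y _ | .z₁ | .z₂ => 2
    | .z₃ | .right => 3
  refine ⟨f, rfl, rfl, fun (v w : RVertex m) (h : (rGraph m).Adj v w) => ?_⟩
  cases v <;> cases w <;> simp [f] at h ⊢

lemma edist_rGraph_left_le (hm : 2 ≤ m) (v : RVertex.{u} m) :
    (rGraph m).edist .left v ≤ (3 : ℕ) := by
  let k₁ : Fin (2 * m) := ⟨1, by omega⟩
  let k₂ : Fin (2 * m) := ⟨2, by omega⟩
  suffices h : v = .left ∨ ∃ i, .x i = v ∨ (rGraph m).Adj (.x i) v ∨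
      ∃ w, (rGraph m).Adj (.x i) w ∧ (rGraph m).Adj w v by
    have hx (i : Fin (2 * m)) : (rGraph.{u} m).Adj .left (.x i) := by simp
    rcases h with rfl | ⟨i, rfl | h | ⟨w, hw, h⟩⟩
    · simp
    · exact (SimpleGraph.edist_le (.cons (hx i) .nil)).trans (by norm_num)
    · exact (SimpleGraph.edist_le (.cons (hx i) (.cons h .nil))).trans (by norm_num)
    · exact SimpleGraph.edist_le (.cons (hx i) (.cons hw (.cons h .nil)))
  rcases v with _ | _ | _ | _ | _ | i | i
  case left => exact .inl rfl
  case x => exact .inr ⟨i, .inl rfl⟩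
  case y =>
    by_cases hi : i.val = 1
    · exact .inr ⟨k₂, .inr (.inl (by simp [k₂, hi]))⟩
    · exact .inr ⟨k₁, .inr (.inl (by simp [k₁, Ne.symm hi]))⟩
  case z₁ => exact .inr ⟨k₁, .inr (.inl (by simp [k₁]; omega))⟩
  case z₂ => exact .inr ⟨k₁, .inr (.inl (by simp [k₁]))⟩
  case z₃ => exact .inr ⟨k₁, .inr (.inr ⟨.z₁, by simp [k₁]; omega, by simp⟩)⟩
  case right => exact .inr ⟨k₁, .inr (.inr ⟨.z₂, by simp [k₁], by simp⟩)⟩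

lemma ediam_graphR_le (hm : 2 ≤ m) : (graphR.{u} m).graph.ediam ≤ (3 : ℕ) := by
  let k₁ : Fin (2 * m) := ⟨1, by omega⟩
  let k₂ : Fin (2 * m) := ⟨2, by omega⟩
  have hhub (v : RVertex.{u} m) (hv : v ≠ .left) :
      (rGraph m).Adj v (.y k₁) ∨ (rGraph m).Adj v (.y k₂) := by
    cases v <;> simp [k₁, k₂] at hv ⊢ <;> omega
  have hk : (rGraph.{u} m).Adj (.y k₁) (.y k₂) := by simp [k₁, k₂]
  refine SimpleGraph.ediam_le_of_edist_le fun (v w : RVertex m) => ?_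
  change (rGraph m).edist v w ≤ _
  by_cases hv : v = .left
  · exact hv ▸ edist_rGraph_left_le hm w
  by_cases hw : w = .left
  · exact hw ▸ SimpleGraph.edist_comm.trans_le (edist_rGraph_left_le hm v)
  exact edist_le_three_of_adj hk (hhub v hv) (hhub w hw)

end R

/-- The vertices of `Q`: in `x₁ i`, `y₁ i`, `x₂ i` and `y₂ i` the subscript is the number of the
copy of `A`. -/
abbrev QVertex (W : Type u) : Type u :=
  {v : AVertex W // v ≠ .right} ⊕ {v : AVertex W // v ≠ .left}

namespace QVertex

variable {W : Type u}

/-- The left vertex of `Q`. -/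
abbrev left : QVertex W := .inl ⟨.left, nofun⟩

/-- The vertex `x_i` of the first copy of `A`. -/
abbrev x₁ (i : W) : QVertex W := .inl ⟨.x i, nofun⟩

/-- The vertex `y_i` of the first copy of `A`. -/
abbrev y₁ (i : W) : QVertex W := .inl ⟨.y i, nofun⟩

/-- The vertex `x_i` of the second copy of `A`. -/
abbrev x₂ (i : W) : QVertex W := .inr ⟨.x i, nofun⟩

/-- The vertex `y_i` of the second copy of `A`. -/
abbrev y₂ (i : W) : QVertex W := .inr ⟨.y i, nofun⟩

/-- The right vertex of `Q`. -/
abbrev right : QVertex W := .inr ⟨.right, nofun⟩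

lemma cases {P : QVertex W → Prop} (left : P left) (x₁ : ∀ i, P (x₁ i)) (y₁ : ∀ i, P (y₁ i))
    (x₂ : ∀ i, P (x₂ i)) (y₂ : ∀ i, P (y₂ i)) (right : P right) : ∀ v, P v
  | .inl ⟨.left, _⟩ => left
  | .inl ⟨.x i, _⟩ => x₁ i
  | .inl ⟨.y i, _⟩ => y₁ i
  | .inr ⟨.x i, _⟩ => x₂ i
  | .inr ⟨.y i, _⟩ => y₂ i
  | .inr ⟨.right, _⟩ => right
  | .inl ⟨.right, h⟩ => (h rfl).elim
  | .inr ⟨.left, h⟩ => (h rfl).elim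

end QVertex

section Q

variable {W : Type u} {H : SimpleGraph W} {v : QVertex W} {i : W}

/-- The graph `Q`, with its vertex type displayed as `QVertex W`. -/
def qGraph (H : SimpleGraph W) : SimpleGraph (QVertex W) := (graphQ H).graph

lemma qGraph_adj_iff {v w : QVertex W} : (qGraph H).Adj v w ↔ QAdj H v w := Iff.rfl

@[simp] lemma qGraph_adj_left_iff : (qGraph H).Adj .left v ↔ ∃ i, v = .x₁ i := by
  induction v using QVertex.cases <;> simp [qGraph_adj_iff, QAdj, graphA, ARel]

@[simp] lemma qGraph_adj_x₁_iff : (qGraph H).Adj (.x₁ i) v ↔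
    v = .left ∨ (∃ j, H.Adj i j ∧ v = .x₁ j) ∨ ∃ j, i ≠ j ∧ v = .y₁ j := by
  have hne (j : W) : ¬ i = j ∧ H.Adj i j ↔ H.Adj i j := and_iff_right_of_imp SimpleGraph.Adj.ne
  induction v using QVertex.cases <;>
    simp [qGraph_adj_iff, QAdj, graphA, ARel, H.adj_comm _ i, hne]

@[simp] lemma qGraph_adj_y₁_iff : (qGraph H).Adj (.y₁ i) v ↔
    (∃ j, i ≠ j ∧ v = .x₁ j) ∨ (∃ j, Hᶜ.Adj i j ∧ v = .y₁ j) ∨ ∃ j, v = .x₂ j := by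
  induction v using QVertex.cases <;>
    simp [qGraph_adj_iff, QAdj, graphA, ARel, H.adj_comm _ i, eq_comm]

@[simp] lemma qGraph_adj_x₂_iff : (qGraph H).Adj (.x₂ i) v ↔
    (∃ j, v = .y₁ j) ∨ (∃ j, H.Adj i j ∧ v = .x₂ j) ∨ ∃ j, i ≠ j ∧ v = .y₂ j := by
  have hne (j : W) : ¬ i = j ∧ H.Adj i j ↔ H.Adj i j := and_iff_right_of_imp SimpleGraph.Adj.ne
  induction v using QVertex.cases <;>
    simp [qGraph_adj_iff, QAdj, graphA, ARel, H.adj_comm _ i, hne]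

@[simp] lemma qGraph_adj_y₂_iff : (qGraph H).Adj (.y₂ i) v ↔
    (∃ j, i ≠ j ∧ v = .x₂ j) ∨ (∃ j, Hᶜ.Adj i j ∧ v = .y₂ j) ∨ v = .right := by
  induction v using QVertex.cases <;>
    simp [qGraph_adj_iff, QAdj, graphA, ARel, H.adj_comm _ i, eq_comm]

@[simp] lemma qGraph_adj_right_iff : (qGraph H).Adj .right v ↔ ∃ i, v = .y₂ i := by
  induction v using QVertex.cases <;> simp [qGraph_adj_iff, QAdj, graphA, ARel]

lemma exists_not_qGraph_adj {c d : QVertex W} (hd : d = .left ∨ ∃ i, d = .x₁ i)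
    (hc : c = .right ∨ ∃ k, c = .y₂ k) (o : W) :
    ∃ v, v ≠ .left ∧ v ≠ .right ∧ ¬ (qGraph H).Adj v d ∧ ¬ (qGraph H).Adj v c ∧
      ∀ s, (qGraph H).Adj v s → ∃ w, w ≠ .left ∧ w ≠ .right ∧
        ¬ (qGraph H).Adj w d ∧ ¬ (qGraph H).Adj w c ∧ ¬ (qGraph H).Adj w s := by
  have hx₂ : ∃ k, ¬ (qGraph H).Adj (.x₂ k) c := by
    rcases hc with rfl | ⟨k, rfl⟩
    · exact ⟨o, by simp⟩
    · exact ⟨k, by simp⟩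
  obtain ⟨k, hk⟩ := hx₂
  rcases hd with rfl | ⟨i, rfl⟩
  · refine ⟨.y₁ o, nofun, nofun, by simp, by rcases hc with rfl | ⟨k, rfl⟩ <;> simp, fun s hs => ?_⟩
    rcases qGraph_adj_y₁_iff.1 hs with ⟨j, -, rfl⟩ | ⟨j, -, rfl⟩ | ⟨j, rfl⟩
    · exact ⟨.x₂ k, nofun, nofun, by simp, hk, by simp⟩
    · exact ⟨.y₁ j, nofun, nofun, by simp, by rcases hc with rfl | ⟨k, rfl⟩ <;> simp, by simp⟩
    · rcases hc with rfl | ⟨k, rfl⟩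
      · exact ⟨.x₂ j, nofun, nofun, by simp, by simp, by simp⟩
      by_cases hkj : H.Adj k j
      · exact ⟨.y₂ j, nofun, nofun, by simp, by simp [hkj.symm], by simp⟩
      · exact ⟨.x₂ k, nofun, nofun, by simp, by simp, by simp [hkj]⟩
  · refine ⟨.y₁ i, nofun, nofun, by simp, by rcases hc with rfl | ⟨k, rfl⟩ <;> simp, fun s hs => ?_⟩
    rcases qGraph_adj_y₁_iff.1 hs with ⟨j, -, rfl⟩ | ⟨j, hij, rfl⟩ | ⟨j, rfl⟩
    · exact ⟨.x₂ k, nofun, nofun, by simp, hk, by simp⟩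
    · have hji : ¬ H.Adj j i := fun h => hij.2 h.symm
      exact ⟨.x₁ j, nofun, nofun, by simp [hji], by rcases hc with rfl | ⟨k, rfl⟩ <;> simp,
        by simp⟩
    · exact ⟨.x₁ i, nofun, nofun, by simp, by rcases hc with rfl | ⟨k, rfl⟩ <;> simp, by simp⟩

lemma exists_pair_y₁_mem {S : Set (QVertex W)} (hS : ∀ i, Dominates (qGraph H) S (.x₁ i))
    (hleft : ¬ (.left ∈ S ∨ Dominates (qGraph H) S .left)) (o : W) :
    ∃ i j, i ≠ j ∧ .y₁ i ∈ S ∧ .y₁ j ∈ S := by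
  have hy₁ (i : W) : ∃ j, i ≠ j ∧ .y₁ j ∈ S := by
    obtain ⟨s, hs, his⟩ := hS i
    rcases qGraph_adj_x₁_iff.1 his with rfl | ⟨j, -, rfl⟩ | ⟨j, hij, rfl⟩
    · exact absurd (.inl hs) hleft
    · exact absurd (.inr ⟨_, hs, by simp⟩) hleft
    · exact ⟨j, hij, hs⟩
  obtain ⟨i, -, hi⟩ := hy₁ o
  obtain ⟨j, hij, hj⟩ := hy₁ i
  exact ⟨i, j, hij, hi, hj⟩

lemma exists_pair_x₂_mem {S : Set (QVertex W)} (hS : ∀ i, Dominates (qGraph H) S (.y₂ i))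
    (hright : ¬ (.right ∈ S ∨ Dominates (qGraph H) S .right)) (o : W) :
    ∃ i j, i ≠ j ∧ .x₂ i ∈ S ∧ .x₂ j ∈ S := by
  have hx₂ (i : W) : ∃ j, i ≠ j ∧ .x₂ j ∈ S := by
    obtain ⟨s, hs, his⟩ := hS i
    rcases qGraph_adj_y₂_iff.1 his with ⟨j, hij, rfl⟩ | ⟨j, -, rfl⟩ | rfl
    · exact ⟨j, hij, hs⟩
    · exact absurd (.inr ⟨_, hs, by simp⟩) hright
    · exact absurd (.inl hs) hright
  obtain ⟨i, -, hi⟩ := hx₂ o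
  obtain ⟨j, hij, hj⟩ := hx₂ i
  exact ⟨i, j, hij, hi, hj⟩

lemma lowerBound_graphQ [Nonempty W] : LowerBound (graphQ H) 3 := by
  refine lowerBound_of_dominates (G := qGraph H) (s := .left) (t := .right) (fun S hS => ?_) nofun
  obtain ⟨o⟩ := ‹Nonempty W›
  have hleft (h : .left ∈ S ∨ Dominates (qGraph H) S .left) :
      ∃ d ∈ S, d = .left ∨ ∃ i, d = .x₁ i := by
    simpa only [mem_or_dominates_iff, qGraph_adj_left_iff] using h
  have hright (h : .right ∈ S ∨ Dominates (qGraph H) S .right) :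
      ∃ c ∈ S, c = .right ∨ ∃ i, c = .y₂ i := by
    simpa only [mem_or_dominates_iff, qGraph_adj_right_iff] using h
  by_cases hL : .left ∈ S ∨ Dominates (qGraph H) S .left
  · obtain ⟨d, hdS, hd⟩ := hleft hL
    by_cases hR : .right ∈ S ∨ Dominates (qGraph H) S .right <;>
      simp only [iverson, hL, hR, if_true, if_false]
    · obtain ⟨c, hcS, hc⟩ := hright hR
      have hdc : d ≠ c := by
        rcases hd with rfl | ⟨i, rfl⟩ <;> rcases hc with rfl | ⟨k, rfl⟩ <;> simp
      obtain ⟨v, hvl, hvr, hvd, hvc, hv⟩ := exists_not_qGraph_adj (H := H) hd hc o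
      obtain ⟨s, hsS, hvs⟩ := hS v hvl hvr
      obtain ⟨w, hwl, hwr, hwd, hwc, hws⟩ := hv s hvs
      have hsd : s ≠ d := by rintro rfl; exact hvd hvs
      have hsc : s ≠ c := by rintro rfl; exact hvc hvs
      exact length_add_one_le_encard (l := [s, d, c]) (by simp [hsd, hsc, hdc])
        (by simp [hsS, hdS, hcS]) (hS w hwl hwr) (by simp [hws, hwd, hwc])
    · obtain ⟨i, j, hij, hi, hj⟩ := exists_pair_x₂_mem (fun i => hS _ nofun nofun) hR o
      exact length_le_encard (l := [d, .x₂ i, .x₂ j])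
        (by rcases hd with rfl | ⟨k, rfl⟩ <;> simp [hij]) (by simp [*])
  · obtain ⟨i, j, hij, hi, hj⟩ := exists_pair_y₁_mem (fun i => hS _ nofun nofun) hL o
    by_cases hR : .right ∈ S ∨ Dominates (qGraph H) S .right <;>
      simp only [iverson, hL, hR, if_true, if_false]
    · obtain ⟨c, hcS, hc⟩ := hright hR
      exact length_le_encard (l := [c, .y₁ i, .y₁ j])
        (by rcases hc with rfl | ⟨k, rfl⟩ <;> simp [hij]) (by simp [*])
    · exact length_le_encard (l := [.y₁ i, .y₁ j]) (by simp [hij]) (by simp [*])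

lemma ne_of_isTotalDominating_pair {p q : W}
    (h : IsTotalDominating H {p, q}) : p ≠ q := by
  rintro rfl
  simpa using h p

lemma exists_list_dominating_compl {p q p' q' : W} (hpq : IsTotalDominating H {p, q})
    (hpq' : IsTotalDominating Hᶜ {p', q'}) (u : QVertex W) :
    ∃ l : List (QVertex W), u ∉ l ∧ l.length ≤ 3 ∧ ∀ v ≠ u,
      (∃ w ∈ l, (qGraph H).Adj v w) ∨ .left ∈ l ∧ v = .left ∨ .right ∈ l ∧ v = .right := by
  induction u using QVertex.cases with
  | left =>
    have hne := ne_of_isTotalDominating_pair hpq'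
    refine ⟨[.right, .y₁ p', .y₁ q'], by simp, le_rfl, fun v hv => ?_⟩
    have hdom (i : W) : Hᶜ.Adj i p' ∨ Hᶜ.Adj i q' := by simpa [IsTotalDominating] using hpq' i
    induction v using QVertex.cases <;> simp at hv hdom ⊢ <;> grind
  | right =>
    have hne := ne_of_isTotalDominating_pair hpq
    refine ⟨[.left, .x₂ p, .x₂ q], by simp, le_rfl, fun v hv => ?_⟩
    have hdom (i : W) : H.Adj i p ∨ H.Adj i q := by simpa [IsTotalDominating] using hpq i
    induction v using QVertex.cases <;> simp at hv ⊢ <;> grind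
  | x₁ i =>
    obtain ⟨k, -, hik⟩ := hpq' i
    refine ⟨[.right, .y₁ i, .x₁ k], by simp [hik.ne], le_rfl, fun v hv => ?_⟩
    induction v using QVertex.cases <;> simp at hv hik ⊢ <;> grind [SimpleGraph.adj_comm]
  | y₁ i =>
    obtain ⟨k, -, hik⟩ := hpq i
    refine ⟨[.right, .x₁ i, .y₁ k], by simp [hik.ne], le_rfl, fun v hv => ?_⟩
    induction v using QVertex.cases <;> simp at hv ⊢ <;> grind [SimpleGraph.adj_comm]
  | x₂ i =>
    obtain ⟨k, -, hik⟩ := hpq' i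
    refine ⟨[.left, .y₂ i, .x₂ k], by simp [hik.ne], le_rfl, fun v hv => ?_⟩
    induction v using QVertex.cases <;> simp at hv hik ⊢ <;> grind [SimpleGraph.adj_comm]
  | y₂ i =>
    obtain ⟨k, -, hik⟩ := hpq i
    refine ⟨[.left, .x₂ i, .y₂ k], by simp [hik.ne], le_rfl, fun v hv => ?_⟩
    induction v using QVertex.cases <;> simp at hv ⊢ <;> grind [SimpleGraph.adj_comm]

lemma upperBound_graphQ {p q p' q' : W} (hpq : IsTotalDominating H {p, q})
    (hpq' : IsTotalDominating Hᶜ {p', q'}) : UpperBound True True (graphQ H) 3 := by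
  refine upperBound_of_lists (G := qGraph H) (fun u => ?_) ?_ ?_
  · simpa only [true_and] using exists_list_dominating_compl hpq hpq' u
  · obtain ⟨k, -, hpk⟩ := hpq' p
    refine ⟨[.left, .right, .x₁ p, .y₁ k], by simp, le_rfl, fun v => ?_⟩
    induction v using QVertex.cases <;> simp at hpk ⊢
    grind [SimpleGraph.adj_comm]
  · obtain ⟨k, -, hpk⟩ := hpq p
    refine ⟨[.left, .right, .x₂ p, .y₂ k], by simp, le_rfl, fun v => ?_⟩
    induction v using QVertex.cases <;> simp at hpk ⊢
    grind [SimpleGraph.adj_comm]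

/-- The layer of a vertex of `Q`, counted from the left vertex; edges stay within a layer or join
consecutive ones. -/
def qLevel : QVertex W → ℕ
  | .inl ⟨.left, _⟩ => 0
  | .inl ⟨.x _, _⟩ => 1
  | .inl ⟨.y _, _⟩ => 2
  | .inr ⟨.x _, _⟩ => 3
  | .inr ⟨.y _, _⟩ => 4
  | .inr ⟨.right, _⟩ => 5

lemma hasLevels_graphQ : HasLevels (graphQ H) 5 := by
  refine ⟨qLevel, rfl, rfl, fun (v w : QVertex W) (h : (qGraph H).Adj v w) => ?_⟩
  induction v using QVertex.cases <;> induction w using QVertex.cases <;> simp [qLevel] at h ⊢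

lemma edist_x₂_le [Nontrivial W] {v : QVertex W} (hv : qLevel v ≤ 2) (j : W) :
    (qGraph H).edist v (.x₂ j) ≤ (3 - qLevel v : ℕ) := by
  have hy₁ (i : W) : (qGraph H).edist (.y₁ i) (.x₂ j) ≤ (1 : ℕ) :=
    (SimpleGraph.edist_eq_one_iff_adj.2 (by simp)).le
  have hx₁ (i : W) : (qGraph H).edist (.x₁ i) (.x₂ j) ≤ (2 : ℕ) := by
    obtain ⟨k, hk⟩ := exists_ne i
    exact edist_le_add_one_of_adj (by simp [hk.symm]) (hy₁ k)
  induction v using QVertex.cases with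
  | left => exact edist_le_add_one_of_adj (by simp) (hx₁ j)
  | x₁ i => exact hx₁ i
  | y₁ i => exact hy₁ i
  | x₂ | y₂ | right => simp [qLevel] at hv

lemma edist_y₁_le [Nontrivial W] {v : QVertex W} (hv : 3 ≤ qLevel v) (j : W) :
    (qGraph H).edist v (.y₁ j) ≤ (qLevel v - 2 : ℕ) := by
  have hx₂ (i : W) : (qGraph H).edist (.x₂ i) (.y₁ j) ≤ (1 : ℕ) :=
    (SimpleGraph.edist_eq_one_iff_adj.2 (by simp)).le
  have hy₂ (i : W) : (qGraph H).edist (.y₂ i) (.y₁ j) ≤ (2 : ℕ) := by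
    obtain ⟨k, hk⟩ := exists_ne i
    exact edist_le_add_one_of_adj (by simp [hk.symm]) (hx₂ k)
  induction v using QVertex.cases with
  | left | x₁ | y₁ => simp [qLevel] at hv
  | x₂ i => exact hx₂ i
  | y₂ i => exact hy₂ i
  | right => exact edist_le_add_one_of_adj (by simp) (hy₂ j)

lemma exists_edist_x₂_le [Nontrivial W] {v : QVertex W} (hv : 3 ≤ qLevel v) :
    ∃ j, (qGraph H).edist v (.x₂ j) ≤ (qLevel v - 3 : ℕ) := by
  have hy₂ (i : W) : ∃ j, (qGraph H).edist (.y₂ i) (.x₂ j) ≤ (1 : ℕ) := by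
    obtain ⟨k, hk⟩ := exists_ne i
    exact ⟨k, (SimpleGraph.edist_eq_one_iff_adj.2 (by simp [hk.symm])).le⟩
  induction v using QVertex.cases with
  | left | x₁ | y₁ => simp [qLevel] at hv
  | x₂ i => exact ⟨i, by simp⟩
  | y₂ i => exact hy₂ i
  | right =>
    obtain ⟨i⟩ := Nontrivial.to_nonempty (α := W)
    obtain ⟨j, hj⟩ := hy₂ i
    exact ⟨j, edist_le_add_one_of_adj (by simp) hj⟩

lemma qLevel_le (v : QVertex W) : qLevel v ≤ 5 := by
  induction v using QVertex.cases <;> simp [qLevel]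

lemma eq_left_of_qLevel_eq {v : QVertex W} (hv : qLevel v = 0) : v = .left := by
  induction v using QVertex.cases <;> simp [qLevel] at hv ⊢

lemma eq_right_of_qLevel_eq {v : QVertex W} (hv : qLevel v = 5) : v = .right := by
  induction v using QVertex.cases <;> simp [qLevel] at hv ⊢

lemma ediam_graphQ_le [Nontrivial W] : (graphQ H).graph.ediam ≤ (5 : ℕ) := by
  have hacross {v w : QVertex W} (hv : qLevel v ≤ 2) (hw : 3 ≤ qLevel w) :
      (qGraph H).edist v w ≤ (5 : ℕ) := by
    obtain ⟨j, hj⟩ := exists_edist_x₂_le (H := H) hw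
    have := qLevel_le w
    exact (edist_le_add (edist_x₂_le hv j) hj).trans (by norm_cast; omega)
  refine SimpleGraph.ediam_le_of_edist_le fun (v w : QVertex W) => ?_
  change (qGraph H).edist v w ≤ _
  by_cases hvw : v = w
  · simp [hvw]
  obtain ⟨j⟩ := Nontrivial.to_nonempty (α := W)
  rcases le_or_gt (qLevel v) 2 with hv | hv <;> rcases le_or_gt (qLevel w) 2 with hw | hw
  · have : ¬ (qLevel v = 0 ∧ qLevel w = 0) := fun h =>
      hvw ((eq_left_of_qLevel_eq h.1).trans (eq_left_of_qLevel_eq h.2).symm)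
    exact (edist_le_add (edist_x₂_le hv j) (edist_x₂_le hw j)).trans (by norm_cast; omega)
  · exact hacross hv hw
  · exact SimpleGraph.edist_comm.trans_le (hacross hw hv)
  · have : ¬ (qLevel v = 5 ∧ qLevel w = 5) := fun h =>
      hvw ((eq_right_of_qLevel_eq h.1).trans (eq_right_of_qLevel_eq h.2).symm)
    have := qLevel_le v
    have := qLevel_le w
    exact (edist_le_add (edist_y₁_le hv j) (edist_y₁_le hw j)).trans (by norm_cast; omega)

end Q

variable {W : Type u} {H : SimpleGraph W} {m : ℕ}

lemma lowerBound_graphRQRR [Nonempty W] (n : ℕ) :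
    LowerBound (graphRQRR H m n) (2 + 3 * n + 2 + 2) :=
  have hQ := dotPow_of_dot lowerBound_point LowerBound.dot (lowerBound_graphQ (H := H)) n
  ((lowerBound_graphR.dot hQ).dot lowerBound_graphR).dot lowerBound_graphR

lemma upperBound_graphRQRR {p q p' q' : W} (hpq : IsTotalDominating H {p, q})
    (hpq' : IsTotalDominating Hᶜ {p', q'}) (hm : 2 ≤ m) (n : ℕ) :
    UpperBound False False (graphRQRR H m n) (2 + 3 * n + 2 + 2) :=
  have hR (el er : Prop) : UpperBound el er (graphR.{u} m) 2 :=
    (upperBound_graphR hm).mono False.elim False.elim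
  have hQ := dotPow_of_dot upperBound_point UpperBound.dot (upperBound_graphQ hpq hpq') n
  (((hR False True).dot hQ).dot (hR True True)).dot (hR True False)

lemma ediam_graphRQRR_le [Nontrivial W] (hm : 2 ≤ m) (n : ℕ) :
    (graphRQRR H m n).graph.ediam ≤ (3 + 5 * n + 3 + 3 : ℕ) :=
  have hR := ediam_graphR_le.{u} hm
  have hQ := dotPow_of_dot (P := fun X k => X.graph.ediam ≤ k) ediam_point_le ediam_dot_le
    (ediam_graphQ_le (H := H)) n
  ediam_dot_le (ediam_dot_le (ediam_dot_le hR hQ) hR) hR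

lemma hasLevels_graphRQRR (n : ℕ) : HasLevels (graphRQRR H m n) (3 + 5 * n + 3 + 3) :=
  have hQ := dotPow_of_dot hasLevels_point HasLevels.dot (hasLevels_graphQ (H := H)) n
  ((hasLevels_graphR.dot hQ).dot hasLevels_graphR).dot hasLevels_graphR

end PointedGraph

end TotalDomination

open TotalDomination PointedGraph in
theorem mainTheorem7_general {W : Type*} (H : SimpleGraph W)
    (hH : totalDominationNumber H = 2) (hHc : totalDominationNumber Hᶜ = 2)
    (m : ℕ) (hm : 2 ≤ m) (n : ℕ) :
    IsKVertexCritical (graphRQRR H m n).graph (3 * n + 7) ∧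
      (graphRQRR H m n).graph.diam = 5 * n + 9 := by
  obtain ⟨p, q, hpq⟩ := exists_isTotalDominating_pair hH
  obtain ⟨p', q', hpq'⟩ := exists_isTotalDominating_pair hHc
  have : Nontrivial W := ⟨p, q, ne_of_isTotalDominating_pair hpq⟩
  constructor
  · have h := isKVertexCritical_of_bounds (lowerBound_graphRQRR n)
      (upperBound_graphRQRR hpq hpq' hm n)
    convert h using 1
    ring
  · rw [diam_eq (ediam_graphRQRR_le hm n) (hasLevels_graphRQRR n)]
    ring

theorem mainTheorem7 {W : Type*} [Fintype W] (H : SimpleGraph W)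
    (hW : 4 ≤ Fintype.card W)
    (hH : TotalDomination.totalDominationNumber H = 2)
    (hHc : TotalDomination.totalDominationNumber Hᶜ = 2)
    (m : ℕ) (hm : 2 ≤ m) (n : ℕ) :
    TotalDomination.IsKVertexCritical (TotalDomination.graphRQRR H m n).graph (3 * n + 7) ∧
      (TotalDomination.graphRQRR H m n).graph.diam = 5 * n + 9 :=
  mainTheorem7_general H hH hHc m hm n
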